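/- Conventions. A quasi-metric on a set $X$ is a function $d\colon X\times X\to[0,\infty)$ with $d(x,z)\le d(x,y)+d(y,z)$ and with $x=y$ if and only if $d(x,y)=d(y,x)=0$; the topology it induces consists of the sets that contain, with each of their points $x$, some ball $\{y : d(x,y)<\varepsilon\}$, $\varepsilon>0$. It is Smyth-complete if every sequence $(x_n)$ such that for each $\varepsilon>0$ one has $d(x_n,x_m)<\varepsilon$ for all sufficiently large $n\le m$ converges with respect to the metric $\max\{d(x,y),d(y,x)\}$. A topological space is quasi-Polish if it is countably based and its topology is induced by a Smyth-complete quasi-metric. A subset $S$ of a space $Y$ is $\Pi^0_2$ if there are open sets $U_i,V_i\subseteq Y$ $(i\in\mathbb N)$ such that $y\in S$ if and only if, for all $i$, $y\in U_i$ implies $y\in V_i$. For a topological space $X$ let $\mathbf A(X)$ be the set of closed subsets of $X$ with the topology generated by the sets $\Diamond U=\{A : A\cap U\neq\emptyset\}$, and let $\mathbf K(X)$ be the set of compact saturated subsets of $X$ (saturated: equal to the intersection of all open neighbourhoods) with the topology generated by the sets $\Box U=\{K : K\subseteq U\}$, where $U$ ranges over the open subsets of $X$. A lens in $X$ is a set of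 the form $A\cap K$ with $A\in\mathbf A(X)$ and $K\in\mathbf K(X)$; the convex (Vietoris) powerspace $\mathbf L(X)$ is the set of lenses in $X$ with the topology generated by all sets $\Diamond U=\{L : L\cap U\ne\emptyset\}$ and $\Box U=\{L : L\subseteq U\}$, $U\subseteq X$ open. The empty set is allowed in all three spaces. Write ${\uparrow}S=\{y\in X : x\in \overline{\{y\}}\text{ for some }x\in S\}$. Theorem. If $X$ is quasi-Polish, then $\mathbf L(X)$ is quasi-Polish. Moreover, $L\mapsto(\overline{L},{\uparrow}L)$ is a well-defined topological embedding of $\mathbf L(X)$ into the product space $\mathbf A(X)\times\mathbf K(X)$, its image is the set of all pairs $(A,K)$ with $\overline{A\cap K}=A$ and ${\uparrow}(A\cap K)=K$, and this image is a $\Pi^0_2$-subset of $\mathbf A(X)\times\mathbf K(X)$. -/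

import Mathlib

open Set Filter Topology

/-! ### Quasi-metrics and quasi-Polish spaces -/

/-- `d` is a quasi-metric on `X`: a nonnegative real-valued function, not necessarily symmetric,
satisfying the triangle inequality and separating points in the sense that
`d x y = d y x = 0` if and only if `x = y`. -/
structure IsQuasiMetric {X : Type*} (d : X → X → ℝ) : Prop where
  nonneg : ∀ x y, 0 ≤ d x y
  eq_iff : ∀ x y, x = y ↔ d x y = 0 ∧ d y x = 0
  triangle : ∀ x y z, d x z ≤ d x y + d y z

/-- The topology of `X` is the one induced by `d`, i.e. the topology in which a set is open
if and only if it contains a forward ball `{y | d x y < ε}` around each of its points `x`. -/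
def InducesTopology {X : Type*} [TopologicalSpace X] (d : X → X → ℝ) : Prop :=
  ∀ U : Set X, IsOpen U ↔ ∀ x ∈ U, ∃ ε > 0, {y | d x y < ε} ⊆ U

/-- A (left) Cauchy sequence for a quasi-metric: `d (x n) (x m) < ε` for all large `n ≤ m`. -/
def IsQuasiCauchy {X : Type*} (d : X → X → ℝ) (x : ℕ → X) : Prop :=
  ∀ ε > 0, ∃ N, ∀ n m, N ≤ n → n ≤ m → d (x n) (x m) < ε

/-- `d` is Smyth-complete: each Cauchy sequence converges with respect to the symmetrized metric
`max (d x y) (d y x)`. -/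
def IsSmythComplete {X : Type*} (d : X → X → ℝ) : Prop :=
  ∀ x : ℕ → X, IsQuasiCauchy d x →
    ∃ a : X, Tendsto (fun n => max (d (x n) a) (d a (x n))) atTop (𝓝 0)

/-- A space is quasi-Polish if it is countably based and its topology is induced by a
Smyth-complete quasi-metric. -/
def IsQuasiPolish (X : Type*) [TopologicalSpace X] : Prop :=
  SecondCountableTopology X ∧
    ∃ d : X → X → ℝ, IsQuasiMetric d ∧ InducesTopology d ∧ IsSmythComplete d

/-- `S` is a `Π⁰₂`-subset of `Y`: there are sequences of open sets `U i`, `V i` such that `y ∈ S`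
if and only if for all `i`, `y ∈ U i` implies `y ∈ V i`. -/
def IsPiZeroTwo {Y : Type*} [TopologicalSpace Y] (S : Set Y) : Prop :=
  ∃ U V : ℕ → Set Y, (∀ i, IsOpen (U i)) ∧ (∀ i, IsOpen (V i)) ∧
    ∀ y, y ∈ S ↔ ∀ i, y ∈ U i → y ∈ V i

/-! ### Saturation -/

/-- A set is saturated if it is the intersection of all its open neighbourhoods. -/
def IsSaturatedSet {X : Type*} [TopologicalSpace X] (K : Set X) : Prop :=
  K = ⋂₀ {U | IsOpen U ∧ K ⊆ U}

/-- `↑S`, the set of points above some point of `S` in the specialization preorder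
(`x ≤ y` if and only if `x ∈ closure {y}`). -/
def specUp {X : Type*} [TopologicalSpace X] (S : Set X) : Set X :=
  {y | ∃ x ∈ S, x ∈ closure {y}}

/-! ### The three powerspaces -/

/-- The lower powerspace `A(X)`: the closed subsets of `X` (including the empty set). -/
@[ext]
structure LowerPowerspace (X : Type*) [TopologicalSpace X] where
  carrier : Set X
  isClosed : IsClosed carrier

/-- The upper powerspace `K(X)`: the compact saturated subsets of `X` (including the empty set). -/
@[ext]
structure UpperPowerspace (X : Type*) [TopologicalSpace X] where
  carrier : Set X
  isCompact : IsCompact carrier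
  isSaturated : IsSaturatedSet carrier

/-- A lens is the intersection of a closed set and a compact saturated set. -/
def IsLens {X : Type*} [TopologicalSpace X] (L : Set X) : Prop :=
  ∃ (A : LowerPowerspace X) (K : UpperPowerspace X), L = A.carrier ∩ K.carrier

/-- The convex powerspace `L(X)`: the lenses in `X` (including the empty set). -/
@[ext]
structure ConvexPowerspace (X : Type*) [TopologicalSpace X] where
  carrier : Set X
  isLens : IsLens carrier

/-- The lower Vietoris topology, generated by the sets `◇U = {A | A ∩ U ≠ ∅}`, `U` open. -/
instance LowerPowerspace.instTopologicalSpace (X : Type*) [TopologicalSpace X] :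
    TopologicalSpace (LowerPowerspace X) :=
  TopologicalSpace.generateFrom
    {W | ∃ U : Set X, IsOpen U ∧ W = {A : LowerPowerspace X | (A.carrier ∩ U).Nonempty}}

/-- The upper Vietoris topology, generated by the sets `□U = {K | K ⊆ U}`, `U` open. -/
instance UpperPowerspace.instTopologicalSpace (X : Type*) [TopologicalSpace X] :
    TopologicalSpace (UpperPowerspace X) :=
  TopologicalSpace.generateFrom
    {W | ∃ U : Set X, IsOpen U ∧ W = {K : UpperPowerspace X | K.carrier ⊆ U}}

/-- The Vietoris topology, generated by the sets `◇U = {L | L ∩ U ≠ ∅}` and `□U = {L | L ⊆ U}`,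
`U` open. -/
instance ConvexPowerspace.instTopologicalSpace (X : Type*) [TopologicalSpace X] :
    TopologicalSpace (ConvexPowerspace X) :=
  TopologicalSpace.generateFrom
    ({W | ∃ U : Set X, IsOpen U ∧ W = {L : ConvexPowerspace X | (L.carrier ∩ U).Nonempty}} ∪
      {W | ∃ U : Set X, IsOpen U ∧ W = {L : ConvexPowerspace X | L.carrier ⊆ U}})

/-!
The proof rests on a combinatorial description of quasi-Polish spaces. A chain presentation of `X`
is a transitive relation `r` on a set `α` of indices and a basis `B a` (`a ∈ α`) of the topology
such that `r a b` implies `B b ⊆ B a`, the indices of the basic neighbourhoods of each point are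
`r`-directed, and every `r`-chain of indices is cofinal in the set of indices of the basic
neighbourhoods of some point. A T₀ space is quasi-Polish if and only if it has such a presentation
with `α` countable.

* A Smyth-complete quasi-metric gives one by formal balls
  (`IsQuasiPolish.exists_chainPresentation`): a second countable quasi-metric
  space has a countable subset `D` dense for the symmetrized metric,
  and the index `(p, n) ∈ D × ℕ` stands for the ball of radius `2⁻ⁿ` about `p`.
* Conversely (`IsChainPresentation.isQuasiPolish`), enumerate the indices, and record for a point
  `x` the least index of a basic neighbourhood of `x` inside each of countably many families, among
  them the families `{c | r a c ∧ r b c}`. The quasi-metric `2⁻ᵏ`, `k` the first family whose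
  recorded index increases, is Smyth-complete: along a Cauchy sequence each record decreases, hence
  is eventually constant, so that the indices of the basic sets containing almost all terms form
  a directed set.

A presentation of `X` on `α` yields a presentation of the convex powerspace on the finite subsets
of `α` with the Egli–Milner relation (`IsChainPresentation.convexPowerspace`). The essential point
is completeness: a chain `F 0, F 1, …` of finite sets presents a lens that contains the limits of
all chains through the levels `F n`, and its compactness comes from König's lemma.

That `L ↦ (closure L, ↑L)` is an embedding with the stated image is elementary, as
`L = closure L ∩ ↑L` for a lens, and `closure L` and `↑L` meet, respectively are contained in, the
same open sets as `L`. The image is `Π⁰₂` since it is described by the conditions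

* `K ⊆ U ∪ V` implies `K ⊆ U` or `A ∩ V ≠ ∅`,
* `K ⊆ U` and `A ∩ V ≠ ∅` imply `A ∩ U ∩ V ≠ ∅`,

for `U` and `V` in a countable basis closed under finite unions
(`IsChainPresentation.mem_range_toProd_iff`). By compactness, the first says that every open neighbourhood of `A ∩ K` contains `K`. The second says that `A ∩ U`
is dense in `A` for each of the countably many basic neighbourhoods `U` of `K`, and by the Baire
property of `A` so is their intersection `A ∩ K`.
-/

universe u v

/-! ### Presentations by chains -/

/-- A presentation of a topological space by a transitive relation `r` on indices and a basis `B`.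
`r a b` is to be read as "`B b` is well inside `B a`": it is stronger than inclusion, and just
strong enough that every chain `s 0, s 1, …` converges, in the sense of being cofinal in the set of
indices of the basic neighbourhoods of a point. Countability of the index type is not included. -/
structure IsChainPresentation {X : Type u} {α : Type v} [TopologicalSpace X]
    (r : α → α → Prop) (B : α → Set X) : Prop where
  trans : ∀ {a b c}, r a b → r b c → r a c
  isOpen : ∀ a, IsOpen (B a)
  anti : ∀ {a b}, r a b → B b ⊆ B a
  exists_subset : ∀ {U : Set X} {x : X}, IsOpen U → x ∈ U → ∃ a, x ∈ B a ∧ B a ⊆ U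
  directed : ∀ {a b : α} {x : X}, x ∈ B a → x ∈ B b → ∃ c, r a c ∧ r b c ∧ x ∈ B c
  complete : ∀ s : ℕ → α, (∀ n, r (s n) (s (n + 1))) → ∃ x, ∀ a, x ∈ B a ↔ ∃ n, r a (s n)

/-! ### Formal balls: quasi-Polish spaces have countable presentations -/

section FormalBalls

variable {X : Type u} {d : X → X → ℝ}

theorem IsQuasiMetric.self (hd : IsQuasiMetric d) (x : X) : d x x = 0 :=
  ((hd.eq_iff x x).1 rfl).1

variable [TopologicalSpace X]

theorem IsQuasiMetric.isOpen_ball (hd : IsQuasiMetric d) (ht : InducesTopology d) (x : X) (ε : ℝ) :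
    IsOpen {y | d x y < ε} := by
  rw [ht]
  intro y hy
  refine ⟨ε - d x y, sub_pos.2 hy, fun z hz => ?_⟩
  have := hd.triangle x y z
  simp only [mem_ofPred_eq] at hz ⊢
  linarith

/-- A second countable quasi-metric space is separable for the symmetrized metric. If `U` is basic
open with `x ∈ U ⊆ ball x ε`, then any `p ∈ U` with `U ⊆ ball p ε` is within `ε` of `x` in both
directions, so it is enough to choose one `p` for each `U` and each `ε = 2⁻ⁿ`. -/
theorem IsQuasiMetric.exists_countable_dense [SecondCountableTopology X] (hd : IsQuasiMetric d)
    (ht : InducesTopology d) :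
    ∃ D : Set X, D.Countable ∧ ∀ x, ∀ ε > 0, ∃ p ∈ D, d p x < ε ∧ d x p < ε := by
  classical
  have hb := TopologicalSpace.isBasis_countableBasis X
  have hc := TopologicalSpace.countable_countableBasis X
  let I := {q : Set X × ℕ // q.1 ∈ TopologicalSpace.countableBasis X ∧
    ∃ x ∈ q.1, q.1 ⊆ {y | d x y < (1 / 2 : ℝ) ^ q.2}}
  have : Countable I := by
    have hS : ({q : Set X × ℕ | q.1 ∈ TopologicalSpace.countableBasis X ∧
        ∃ x ∈ q.1, q.1 ⊆ {y | d x y < (1 / 2 : ℝ) ^ q.2}}).Countable :=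
      (hc.prod (countable_univ (α := ℕ))).mono fun q hq => mem_prod.2 ⟨hq.1, mem_univ _⟩
    exact hS.to_subtype
  choose f hf using fun q : I => q.2.2
  refine ⟨range f, countable_range f, fun x ε hε => ?_⟩
  obtain ⟨n, hn⟩ := exists_pow_lt_of_lt_one hε (by norm_num : (1 / 2 : ℝ) < 1)
  obtain ⟨U, hU, hxU, hUs⟩ := hb.exists_subset_of_mem_open
    (show x ∈ {y | d x y < (1 / 2 : ℝ) ^ n} by simp [hd.self]) (hd.isOpen_ball ht x _)
  let q : I := ⟨(U, n), hU, x, hxU, hUs⟩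
  exact ⟨f q, mem_range_self q, ((hf q).2 hxU).trans hn, (hUs (hf q).1).trans hn⟩

/-- The index `(p, n)` is the formal ball of centre `p` and radius `2⁻ⁿ`. The relation
`d p q + 2⁻ᵐ < 2⁻ⁿ` between `(p, n)` and `(q, m)` forces `n < m`, so that radii tend to `0` along
chains, and the centres then form a Cauchy sequence. -/
theorem IsQuasiPolish.exists_chainPresentation (hX : IsQuasiPolish X) :
    ∃ (α : Type u) (r : α → α → Prop) (B : α → Set X), Countable α ∧ IsChainPresentation r B := by
  obtain ⟨_, d, hd, ht, hs⟩ := hX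
  obtain ⟨D, hDc, hD⟩ := hd.exists_countable_dense ht
  have := hDc.to_subtype
  have hhalf : (1 / 2 : ℝ) < 1 := by norm_num
  have htrans : ∀ {a b c : D × ℕ}, d a.1 b.1 + (1 / 2 : ℝ) ^ b.2 < (1 / 2) ^ a.2 →
      d b.1 c.1 + (1 / 2 : ℝ) ^ c.2 < (1 / 2) ^ b.2 →
      d a.1 c.1 + (1 / 2 : ℝ) ^ c.2 < (1 / 2) ^ a.2 := by
    intro a b c h1 h2
    linarith [hd.triangle a.1 b.1 c.1]
  -- arbitrarily small formal balls contain `x`, with centres close to `x` in both directions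
  have hsmall : ∀ (x : X) (η : ℝ), 0 < η → ∃ c : D × ℕ, d c.1 x < (1 / 2) ^ c.2 ∧
      d x c.1 + (1 / 2) ^ c.2 < η := by
    intro x η hη
    obtain ⟨n, hn⟩ := exists_pow_lt_of_lt_one (half_pos hη) hhalf
    obtain ⟨p, hp, h1, h2⟩ := hD x ((1 / 2) ^ n) (by positivity)
    exact ⟨(⟨p, hp⟩, n), h1, by simp only; linarith⟩
  refine ⟨D × ℕ, fun a b => d a.1 b.1 + (1 / 2 : ℝ) ^ b.2 < (1 / 2) ^ a.2,
    fun a => {x | d a.1 x < (1 / 2) ^ a.2}, inferInstance,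
    htrans, fun a => hd.isOpen_ball ht _ _, ?_, ?_, ?_, ?_⟩
  · intro a b hab x hx
    simp only [mem_ofPred_eq] at hx ⊢
    linarith [hd.triangle a.1 b.1 x]
  · intro U x hU hx
    obtain ⟨ε, hε, hεU⟩ := (ht U).1 hU x hx
    obtain ⟨c, hc1, hc2⟩ := hsmall x ε hε
    refine ⟨c, hc1, fun y hy => hεU ?_⟩
    simp only [mem_ofPred_eq] at hy ⊢
    linarith [hd.triangle x c.1 y]
  · intro a b x ha hb
    simp only [mem_ofPred_eq] at ha hb
    obtain ⟨c, hc1, hc2⟩ := hsmall x (min ((1 / 2) ^ a.2 - d a.1 x) ((1 / 2) ^ b.2 - d b.1 x))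
      (lt_min (sub_pos.2 ha) (sub_pos.2 hb))
    rw [lt_min_iff] at hc2
    refine ⟨c, ?_, ?_, hc1⟩
    · linarith [hd.triangle a.1 x c.1]
    · linarith [hd.triangle b.1 x c.1]
  · intro s hss
    have hmono : ∀ n m, n < m →
        d (s n).1 (s m).1 + (1 / 2 : ℝ) ^ (s m).2 < (1 / 2) ^ (s n).2 := by
      intro n m hnm
      induction m, hnm using Nat.le_induction with
      | base => exact hss n
      | succ m _ ih => exact htrans ih (hss m)
    have hrad : ∀ n, (1 / 2 : ℝ) ^ (s n).2 ≤ (1 / 2) ^ n := by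
      intro n
      refine pow_le_pow_of_le_one (by norm_num) hhalf.le ?_
      have : StrictMono fun n => (s n).2 := strictMono_nat_of_lt_succ fun n =>
        (pow_lt_pow_iff_right_of_lt_one₀ (by norm_num) hhalf).1
          (by linarith [hss n, hd.nonneg (s n).1 (s (n + 1)).1])
      exact this.id_le n
    have hcau : IsQuasiCauchy d fun n => ((s n).1 : X) := by
      intro ε hε
      obtain ⟨N, hN⟩ := exists_pow_lt_of_lt_one hε hhalf
      refine ⟨N, fun n m hn hnm => ?_⟩
      rcases hnm.eq_or_lt with rfl | hlt
      · simpa [hd.self] using hε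
      · have h1 : (1 / 2 : ℝ) ^ n ≤ (1 / 2) ^ N := pow_le_pow_of_le_one (by norm_num) hhalf.le hn
        have h2 : (0 : ℝ) < (1 / 2) ^ (s m).2 := by positivity
        linarith [hmono n m hlt, hrad n]
    obtain ⟨x, hx⟩ := hs _ hcau
    have hev : ∀ ε > 0, ∀ᶠ n in atTop, d (s n).1 x < ε ∧ d x (s n).1 < ε := fun ε hε =>
      (hx.eventually (gt_mem_nhds hε)).mono fun n hn => max_lt_iff.1 hn
    have hle : ∀ n, d (s n).1 x ≤ (1 / 2) ^ (s n).2 := by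
      intro n
      refine le_of_forall_pos_le_add fun ε hε => ?_
      obtain ⟨m, hm, hnm⟩ := ((hev ε hε).and (eventually_gt_atTop n)).exists
      have h2 : (0 : ℝ) < (1 / 2) ^ (s m).2 := by positivity
      linarith [hmono n m hnm, hd.triangle (s n).1 (s m).1 x, hm.1]
    refine ⟨x, fun a => ⟨fun ha => ?_, fun ⟨n, hn⟩ => ?_⟩⟩
    · simp only [mem_ofPred_eq] at ha
      have hη : 0 < ((1 / 2) ^ a.2 - d a.1 x) / 2 := half_pos (sub_pos.2 ha)
      obtain ⟨N, hN⟩ := exists_pow_lt_of_lt_one hη hhalf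
      obtain ⟨n, hn, hNn⟩ := ((hev _ hη).and (eventually_ge_atTop N)).exists
      have h1 : (1 / 2 : ℝ) ^ n ≤ (1 / 2) ^ N := pow_le_pow_of_le_one (by norm_num) hhalf.le hNn
      exact ⟨n, by linarith [hd.triangle a.1 x (s n).1, hn.2, hrad n]⟩
    · simp only [mem_ofPred_eq]
      linarith [hd.triangle a.1 (s n).1 x, hle n]

end FormalBalls

/-! ### The embedding into the product of the lower and the upper powerspace -/

section Saturation

variable {X : Type u} [TopologicalSpace X]

theorem subset_specUp (S : Set X) : S ⊆ specUp S := fun x hx => ⟨x, hx, subset_closure rfl⟩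

theorem specUp_subset_of_isOpen {S U : Set X} (hU : IsOpen U) : specUp S ⊆ U ↔ S ⊆ U := by
  refine ⟨(subset_specUp S).trans, fun h y ⟨x, hx, hxy⟩ => ?_⟩
  obtain ⟨z, hzU, rfl⟩ := mem_closure_iff.1 hxy U hU (h hx)
  exact hzU

theorem exists_isOpen_of_notMem_specUp {S : Set X} {y : X} (hy : y ∉ specUp S) :
    ∃ U, IsOpen U ∧ S ⊆ U ∧ y ∉ U :=
  ⟨(closure {y})ᶜ, isClosed_closure.isOpen_compl, fun x hx hxy => hy ⟨x, hx, hxy⟩,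
    fun h => h (subset_closure rfl)⟩

theorem isSaturatedSet_specUp (S : Set X) : IsSaturatedSet (specUp S) := by
  refine Subset.antisymm (fun y hy U hU => hU.2 hy) fun y hy => ?_
  by_contra h
  obtain ⟨U, hU, hSU, hyU⟩ := exists_isOpen_of_notMem_specUp h
  exact hyU (hy U ⟨hU, (specUp_subset_of_isOpen hU).2 hSU⟩)

theorem IsSaturatedSet.specUp_subset {S K : Set X} (hK : IsSaturatedSet K) (h : S ⊆ K) :
    specUp S ⊆ K := by
  rw [hK]
  exact fun y hy U hU => (specUp_subset_of_isOpen hU.1).2 (h.trans hU.2) hy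

theorem IsCompact.specUp {S : Set X} (hS : IsCompact S) : IsCompact (specUp S) := by
  refine isCompact_of_finite_subcover fun U hU hcov => ?_
  obtain ⟨t, ht⟩ := hS.elim_finite_subcover U hU ((subset_specUp S).trans hcov)
  exact ⟨t, (specUp_subset_of_isOpen (isOpen_biUnion fun i _ => hU i)).2 ht⟩

theorem IsLens.isCompact {L : Set X} (hL : IsLens L) : IsCompact L := by
  obtain ⟨A, K, rfl⟩ := hL
  exact K.isCompact.inter_left A.isClosed

/-- A lens is recovered from its closure and its saturation. -/
theorem IsLens.closure_inter_specUp {L : Set X} (hL : IsLens L) : closure L ∩ specUp L = L := by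
  refine Subset.antisymm ?_ (subset_inter subset_closure (subset_specUp L))
  obtain ⟨A, K, rfl⟩ := hL
  exact inter_subset_inter (A.isClosed.closure_subset_iff.2 inter_subset_left)
    (K.isSaturated.specUp_subset inter_subset_right)

/-- The pair `(closure L, ↑L)` attached to a lens `L`. -/
def ConvexPowerspace.toProd (L : ConvexPowerspace X) : LowerPowerspace X × UpperPowerspace X :=
  (⟨closure L.carrier, isClosed_closure⟩,
    ⟨specUp L.carrier, L.isLens.isCompact.specUp, isSaturatedSet_specUp _⟩)

theorem LowerPowerspace.isOpen_diamond {U : Set X} (hU : IsOpen U) :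
    IsOpen {A : LowerPowerspace X | (A.carrier ∩ U).Nonempty} :=
  .basic _ ⟨U, hU, rfl⟩

theorem UpperPowerspace.isOpen_box {U : Set X} (hU : IsOpen U) :
    IsOpen {K : UpperPowerspace X | K.carrier ⊆ U} :=
  .basic _ ⟨U, hU, rfl⟩

theorem ConvexPowerspace.isOpen_diamond {U : Set X} (hU : IsOpen U) :
    IsOpen {L : ConvexPowerspace X | (L.carrier ∩ U).Nonempty} :=
  .basic _ (.inl ⟨U, hU, rfl⟩)

theorem ConvexPowerspace.isOpen_box {U : Set X} (hU : IsOpen U) :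
    IsOpen {L : ConvexPowerspace X | L.carrier ⊆ U} :=
  .basic _ (.inr ⟨U, hU, rfl⟩)

theorem ConvexPowerspace.toProd_fst_inter_nonempty {L : ConvexPowerspace X} {U : Set X}
    (hU : IsOpen U) : (L.toProd.1.carrier ∩ U).Nonempty ↔ (L.carrier ∩ U).Nonempty :=
  closure_inter_open_nonempty_iff hU

theorem ConvexPowerspace.toProd_snd_subset {L : ConvexPowerspace X} {U : Set X}
    (hU : IsOpen U) : L.toProd.2.carrier ⊆ U ↔ L.carrier ⊆ U :=
  specUp_subset_of_isOpen hU

theorem ConvexPowerspace.toProd_injective :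
    Function.Injective (toProd : ConvexPowerspace X → _) := by
  intro L M h
  ext1
  have h1 : closure L.carrier = closure M.carrier := congrArg (fun p => p.1.carrier) h
  have h2 : specUp L.carrier = specUp M.carrier := congrArg (fun p => p.2.carrier) h
  rw [← L.isLens.closure_inter_specUp, ← M.isLens.closure_inter_specUp, h1, h2]

theorem ConvexPowerspace.isEmbedding_toProd :
    IsEmbedding (toProd : ConvexPowerspace X → LowerPowerspace X × UpperPowerspace X) := by
  refine ⟨⟨le_antisymm ?_ ?_⟩, toProd_injective⟩
  · rw [← continuous_iff_le_induced]
    refine Continuous.prodMk (continuous_generateFrom_iff.2 ?_) (continuous_generateFrom_iff.2 ?_)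
    · rintro _ ⟨U, hU, rfl⟩
      convert isOpen_diamond hU using 1
      ext L
      exact toProd_fst_inter_nonempty hU
    · rintro _ ⟨U, hU, rfl⟩
      convert isOpen_box hU using 1
      ext L
      exact toProd_snd_subset hU
  · refine le_generateFrom ?_
    rintro _ (⟨U, hU, rfl⟩ | ⟨U, hU, rfl⟩)
    · refine ⟨_, (LowerPowerspace.isOpen_diamond hU).preimage continuous_fst, ?_⟩
      ext L
      exact toProd_fst_inter_nonempty hU
    · refine ⟨_, (UpperPowerspace.isOpen_box hU).preimage continuous_snd, ?_⟩
      ext L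
      exact toProd_snd_subset hU

theorem ConvexPowerspace.range_toProd :
    range (toProd : ConvexPowerspace X → _) =
      {p | closure (p.1.carrier ∩ p.2.carrier) = p.1.carrier ∧
        specUp (p.1.carrier ∩ p.2.carrier) = p.2.carrier} := by
  ext ⟨A, K⟩
  constructor
  · rintro ⟨L, hL⟩
    simp only [← hL, mem_ofPred_eq, toProd, L.isLens.closure_inter_specUp, and_self]
  · rintro ⟨h1, h2⟩
    exact ⟨⟨A.carrier ∩ K.carrier, A, K, rfl⟩,
      Prod.ext (LowerPowerspace.ext h1) (UpperPowerspace.ext h2)⟩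

instance ConvexPowerspace.instT0Space : T0Space (ConvexPowerspace X) := by
  refine ⟨fun L M h => toProd_injective (Prod.ext (LowerPowerspace.ext ?_)
    (UpperPowerspace.ext ?_))⟩
  · ext x
    simp only [toProd, mem_closure_iff, inter_comm _ (carrier _)]
    exact forall₃_congr fun U hU _ => h.mem_open_iff (isOpen_diamond hU)
  · have key : ∀ {L M : ConvexPowerspace X}, Inseparable L M →
        specUp L.carrier ⊆ specUp M.carrier := by
      intro L M h y hy
      by_contra hyM
      obtain ⟨U, hU, hMU, hyU⟩ := exists_isOpen_of_notMem_specUp hyM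
      exact hyU ((specUp_subset_of_isOpen hU).2
        ((h.mem_open_iff (isOpen_box hU)).2 hMU) hy)
    exact (key h).antisymm (key h.symm)

end Saturation

/-! ### König's lemma for finite levels -/

section Konig

variable {α : Type v} {r : α → α → Prop}

/-- König's lemma, for levels `F n` whose elements in `P` have predecessors in `P` one level below.
A path of length `m` is chosen for each `m`, and the chain is the limit of these paths along
a nonprincipal ultrafilter. -/
theorem exists_chain_of_finset_levels (F : ℕ → Finset α) (P : α → Prop)
    (hne : ∀ n, ∃ a ∈ F n, P a)
    (hpred : ∀ n, ∀ b ∈ F (n + 1), P b → ∃ a ∈ F n, P a ∧ r a b) :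
    ∃ s : ℕ → α, (∀ n, s n ∈ F n) ∧ (∀ n, P (s n)) ∧ ∀ n, r (s n) (s (n + 1)) := by
  classical
  have hpath : ∀ m, ∀ c ∈ F m, P c → ∃ p : ℕ → α, p m = c ∧
      (∀ i ≤ m, p i ∈ F i ∧ P (p i)) ∧ ∀ i < m, r (p i) (p (i + 1)) := by
    intro m
    induction m with
    | zero =>
      intro c hc hPc
      refine ⟨fun _ => c, rfl, fun i hi => ?_, fun i hi => absurd hi (Nat.not_lt_zero i)⟩
      obtain rfl := Nat.le_zero.1 hi
      exact ⟨hc, hPc⟩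
    | succ m ih =>
      intro c hc hPc
      obtain ⟨b, hb, hPb, hbc⟩ := hpred m c hc hPc
      obtain ⟨p, hpm, hp, hpr⟩ := ih b hb hPb
      refine ⟨Function.update p (m + 1) c, Function.update_self .., fun i hi => ?_, fun i hi => ?_⟩
      · rcases hi.eq_or_lt with rfl | hlt
        · simpa using ⟨hc, hPc⟩
        · rw [Function.update_of_ne hlt.ne]
          exact hp i (Nat.lt_succ_iff.1 hlt)
      · rw [Function.update_of_ne hi.ne]
        rcases (Nat.lt_succ_iff.1 hi).eq_or_lt with rfl | hlt
        · rwa [Function.update_self, hpm]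
        · rw [Function.update_of_ne (by omega)]
          exact hpr i hlt
  choose c hc hPc using hne
  choose p _ hp hpr using fun m => hpath m (c m) (hc m) (hPc m)
  have hge : ∀ i, ∀ᶠ m in (hyperfilter ℕ : Filter ℕ), i < m := fun i =>
    Nat.hyperfilter_le_atTop (eventually_gt_atTop i)
  have hlim : ∀ i, ∃ a ∈ F i, ∀ᶠ m in (hyperfilter ℕ : Filter ℕ), p m i = a := by
    intro i
    have : ∀ᶠ m in (hyperfilter ℕ : Filter ℕ), ∃ a ∈ (F i : Set α), p m i = a :=
      (hge i).mono fun m hm => ⟨_, (hp m i hm.le).1, rfl⟩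
    exact (Ultrafilter.eventually_exists_mem_iff (F i).finite_toSet).1 this
  choose s hsF hs using hlim
  refine ⟨s, hsF, fun n => ?_, fun n => ?_⟩
  · obtain ⟨m, hm, hnm⟩ := ((hs n).and (hge n)).exists
    exact hm ▸ (hp m n hnm.le).2
  · obtain ⟨m, ⟨hm, hm'⟩, hnm⟩ := (((hs n).and (hs (n + 1))).and (hge n)).exists
    exact hm ▸ hm' ▸ hpr m n hnm

end Konig

/-! ### The presentation of the convex powerspace -/

/-- The Egli–Milner lift of a relation to finite sets. -/
def EgliMilner {α : Type v} (r : α → α → Prop) (F G : Finset α) : Prop :=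
  (∀ a ∈ F, ∃ b ∈ G, r a b) ∧ ∀ b ∈ G, ∃ a ∈ F, r a b

/-- The basic open set `□(⋃ a ∈ F, B a) ∩ ⋂ a ∈ F, ◇(B a)` of lenses that are covered by the sets
`B a`, `a ∈ F`, and meet each of them. -/
def lensBasic {X : Type u} {α : Type v} [TopologicalSpace X] (B : α → Set X) (F : Finset α) :
    Set (ConvexPowerspace X) :=
  {L | L.carrier ⊆ ⋃ a ∈ F, B a} ∩ ⋂ a ∈ F, {L | (L.carrier ∩ B a).Nonempty}

namespace IsChainPresentation

variable {X : Type u} {α : Type v} [TopologicalSpace X] {r : α → α → Prop} {B : α → Set X}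

theorem mem_lensBasic {F : Finset α} {L : ConvexPowerspace X} :
    L ∈ lensBasic B F ↔ (∀ x ∈ L.carrier, ∃ a ∈ F, x ∈ B a) ∧
      ∀ a ∈ F, ∃ x ∈ L.carrier, x ∈ B a := by
  simp only [lensBasic, mem_inter_iff, mem_ofPred_eq, subset_def, mem_iUnion, exists_prop,
    mem_iInter, Set.Nonempty]

theorem isOpen_lensBasic (h : IsChainPresentation r B) (F : Finset α) :
    IsOpen (lensBasic B F) :=
  (ConvexPowerspace.isOpen_box (isOpen_biUnion fun a _ => h.isOpen a)).inter
    (isOpen_biInter_finset fun a _ => ConvexPowerspace.isOpen_diamond (h.isOpen a))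

theorem egliMilner_trans (h : IsChainPresentation r B) {F G H : Finset α}
    (hFG : EgliMilner r F G) (hGH : EgliMilner r G H) : EgliMilner r F H := by
  refine ⟨fun a ha => ?_, fun c hc => ?_⟩
  · obtain ⟨b, hb, hab⟩ := hFG.1 a ha
    obtain ⟨c, hc, hbc⟩ := hGH.1 b hb
    exact ⟨c, hc, h.trans hab hbc⟩
  · obtain ⟨b, hb, hbc⟩ := hGH.2 c hc
    obtain ⟨a, ha, hab⟩ := hFG.2 b hb
    exact ⟨a, ha, h.trans hab hbc⟩

theorem lensBasic_anti (h : IsChainPresentation r B) {F G : Finset α} (hFG : EgliMilner r F G) :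
    lensBasic B G ⊆ lensBasic B F := by
  intro L hL
  rw [mem_lensBasic] at hL ⊢
  refine ⟨fun x hx => ?_, fun a ha => ?_⟩
  · obtain ⟨b, hb, hxb⟩ := hL.1 x hx
    obtain ⟨a, ha, hab⟩ := hFG.2 b hb
    exact ⟨a, ha, h.anti hab hxb⟩
  · obtain ⟨b, hb, hab⟩ := hFG.1 a ha
    obtain ⟨x, hx, hxb⟩ := hL.2 b hb
    exact ⟨x, hx, h.anti hab hxb⟩

theorem directed_finset (h : IsChainPresentation r B) (F : Finset α) {x : X}
    (hx : ∀ a ∈ F, x ∈ B a) : ∃ c, x ∈ B c ∧ ∀ a ∈ F, r a c := by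
  classical
  induction F using Finset.induction_on with
  | empty =>
    obtain ⟨c, hc, -⟩ := h.exists_subset isOpen_univ (mem_univ x)
    exact ⟨c, hc, by simp⟩
  | insert a F _ ih =>
    obtain ⟨c, hc, hF⟩ := ih fun b hb => hx b (Finset.mem_insert_of_mem hb)
    obtain ⟨e, hae, hce, he⟩ := h.directed (hx a (Finset.mem_insert_self a F)) hc
    refine ⟨e, he, fun b hb => ?_⟩
    rcases Finset.mem_insert.1 hb with rfl | hb
    · exact hae
    · exact h.trans (hF b hb) hce

/-- A choice of a basic neighbourhood `B (c x)` of each point `x` of a lens can be thinned out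
to finitely many points `x ∈ T`, keeping those of a prescribed finite set `C`. -/
theorem exists_finset_mem_lensBasic (h : IsChainPresentation r B) (L : ConvexPowerspace X)
    (c : X → α) (hc : ∀ x ∈ L.carrier, x ∈ B (c x)) (C : Finset X) (hC : ∀ x ∈ C, x ∈ L.carrier) :
    ∃ T : Finset X, C ⊆ T ∧ (∀ x ∈ T, x ∈ L.carrier) ∧
      ∃ F : Finset α, (∀ a, a ∈ F ↔ ∃ x ∈ T, c x = a) ∧ L ∈ lensBasic B F := by
  classical
  obtain ⟨t, htL, ht⟩ := L.isLens.isCompact.elim_nhds_subcover (fun x => B (c x))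
    fun x hx => (h.isOpen _).mem_nhds (hc x hx)
  have hT : ∀ x ∈ C ∪ t, x ∈ L.carrier := fun x hx =>
    (Finset.mem_union.1 hx).elim (hC x) (htL x)
  refine ⟨C ∪ t, Finset.subset_union_left, hT, (C ∪ t).image c, fun a => Finset.mem_image,
    mem_lensBasic.2 ⟨fun x hx => ?_, fun a ha => ?_⟩⟩
  · obtain ⟨y, hy, hxy⟩ := mem_iUnion₂.1 (ht hx)
    exact ⟨c y, Finset.mem_image_of_mem c (Finset.mem_union_right _ hy), hxy⟩
  · obtain ⟨x, hx, rfl⟩ := Finset.mem_image.1 ha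
    exact ⟨x, hT x hx, hc x (hT x hx)⟩

/-- The index chosen at a point `x` lies above all indices in `F ∪ G` of neighbourhoods of `x`.
The finite set of points retained contains a point of `B a` for each `a ∈ F ∪ G`. -/
theorem lensBasic_directed (h : IsChainPresentation r B) {F G : Finset α} {L : ConvexPowerspace X}
    (hF : L ∈ lensBasic B F) (hG : L ∈ lensBasic B G) :
    ∃ H, EgliMilner r F H ∧ EgliMilner r G H ∧ L ∈ lensBasic B H := by
  classical
  rw [mem_lensBasic] at hF hG
  have hc : ∀ x, ∃ c, x ∈ B c ∧ ∀ a ∈ F ∪ G, x ∈ B a → r a c := fun x => by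
    obtain ⟨c, hxc, hc⟩ := h.directed_finset ((F ∪ G).filter fun a => x ∈ B a) (x := x)
      fun a ha => (Finset.mem_filter.1 ha).2
    exact ⟨c, hxc, fun a ha hxa => hc a (Finset.mem_filter.2 ⟨ha, hxa⟩)⟩
  choose c hxc hc using hc
  have hp : ∀ a : {a // a ∈ F ∪ G}, ∃ x ∈ L.carrier, x ∈ B a := fun a =>
    (Finset.mem_union.1 a.2).elim (hF.2 a) (hG.2 a)
  choose p hpL hpB using hp
  obtain ⟨T, hpT, hTL, H, hH, hLH⟩ := h.exists_finset_mem_lensBasic L c (fun x _ => hxc x)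
    (Finset.univ.image p) (Finset.forall_mem_image.2 fun a _ => hpL a)
  have key : ∀ E ⊆ F ∪ G, (∀ x ∈ L.carrier, ∃ a ∈ E, x ∈ B a) → EgliMilner r E H := by
    refine fun E hE hcov => ⟨fun a ha => ?_, fun b hb => ?_⟩
    · have hx : p ⟨a, hE ha⟩ ∈ T := hpT (Finset.mem_image_of_mem p (Finset.mem_univ _))
      exact ⟨_, (hH _).2 ⟨_, hx, rfl⟩, hc _ a (hE ha) (hpB ⟨a, hE ha⟩)⟩
    · obtain ⟨x, hx, rfl⟩ := (hH b).1 hb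
      obtain ⟨a, ha, hxa⟩ := hcov x (hTL x hx)
      exact ⟨a, ha, hc x a (hE ha) hxa⟩
  exact ⟨H, key F Finset.subset_union_left hF.1, key G Finset.subset_union_right hG.1, hLH⟩

/-- The sets `lensBasic B F` form a basis of the convex powerspace. -/
theorem exists_lensBasic_subset (h : IsChainPresentation r B) {W : Set (ConvexPowerspace X)}
    (hW : IsOpen W) {L : ConvexPowerspace X} (hL : L ∈ W) :
    ∃ F, L ∈ lensBasic B F ∧ lensBasic B F ⊆ W := by
  classical
  have hnhds : ∀ (N : X → Set X), (∀ x, IsOpen (N x)) → (∀ x ∈ L.carrier, x ∈ N x) →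
      ∀ C : Finset X, (∀ x ∈ C, x ∈ L.carrier) → ∃ F, L ∈ lensBasic B F ∧
        (∀ a ∈ F, ∃ x, B a ⊆ N x) ∧ ∀ x ∈ C, ∃ a ∈ F, B a ⊆ N x := by
    intro N hN hLN C hC
    have hc : ∀ x, ∃ a, x ∈ L.carrier → x ∈ B a ∧ B a ⊆ N x := fun x => by
      by_cases hx : x ∈ L.carrier
      · obtain ⟨a, ha⟩ := h.exists_subset (hN x) (hLN x hx)
        exact ⟨a, fun _ => ha⟩
      · obtain ⟨a, -⟩ := h.exists_subset isOpen_univ (mem_univ x)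
        exact ⟨a, fun hx' => absurd hx' hx⟩
    choose c hc using hc
    obtain ⟨T, hCT, hTL, F, hF, hLF⟩ :=
      h.exists_finset_mem_lensBasic L c (fun x hx => (hc x hx).1) C hC
    refine ⟨F, hLF, fun a ha => ?_, fun x hx => ?_⟩
    · obtain ⟨x, hx, rfl⟩ := (hF a).1 ha
      exact ⟨x, (hc x (hTL x hx)).2⟩
    · exact ⟨c x, (hF _).2 ⟨x, hCT hx, rfl⟩, (hc x (hC x hx)).2⟩
  induction hW with
  | basic W hW =>
    rcases hW with ⟨U, hU, rfl⟩ | ⟨U, hU, rfl⟩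
    · obtain ⟨x₀, hx₀, hxU⟩ := hL
      obtain ⟨F, hLF, -, hF⟩ := hnhds (fun x => if x ∈ U then U else univ)
        (fun x => by split_ifs <;> simp [hU]) (fun x _ => by split_ifs <;> simp [*]) {x₀}
        (by simpa using hx₀)
      obtain ⟨a, ha, haU⟩ := hF x₀ (Finset.mem_singleton_self x₀)
      rw [if_pos hxU] at haU
      refine ⟨F, hLF, fun M hM => ?_⟩
      obtain ⟨y, hyM, hya⟩ := (mem_lensBasic.1 hM).2 a ha
      exact ⟨y, hyM, haU hya⟩
    · obtain ⟨F, hLF, hF, -⟩ := hnhds (fun _ => U) (fun _ => hU) (fun x hx => hL hx) ∅ (by simp)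
      refine ⟨F, hLF, fun M hM y hy => ?_⟩
      obtain ⟨a, ha, hya⟩ := (mem_lensBasic.1 hM).1 y hy
      obtain ⟨-, haU⟩ := hF a ha
      exact haU hya
  | univ =>
    obtain ⟨F, hLF, -⟩ := hnhds (fun _ => univ) (fun _ => isOpen_univ) (fun _ _ => mem_univ _) ∅
      (by simp)
    exact ⟨F, hLF, subset_univ _⟩
  | inter V W _ _ ihV ihW =>
    obtain ⟨F, hLF, hF⟩ := ihV hL.1
    obtain ⟨G, hLG, hG⟩ := ihW hL.2
    obtain ⟨H, hFH, hGH, hLH⟩ := h.lensBasic_directed hLF hLG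
    exact ⟨H, hLH, subset_inter ((h.lensBasic_anti hFH).trans hF)
      ((h.lensBasic_anti hGH).trans hG)⟩
  | sUnion S _ ih =>
    obtain ⟨V, hVS, hLV⟩ := hL
    obtain ⟨F, hLF, hF⟩ := ih V hVS hLV
    exact ⟨F, hLF, hF.trans (subset_sUnion_of_mem hVS)⟩

/-- The lens presented by an Egli–Milner chain `F` is `A ∩ K`, where `K` consists of the points
having a neighbourhood `B a` with `a` in each level, and `A` of the points all of whose basic
neighbourhoods have an index below some element of a level. -/
theorem exists_lens_of_egliMilner_chain (h : IsChainPresentation r B) (F : ℕ → Finset α)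
    (hF : ∀ n, EgliMilner r (F n) (F (n + 1))) :
    ∃ L : ConvexPowerspace X, ∀ G, L ∈ lensBasic B G ↔ ∃ n, EgliMilner r G (F n) := by
  have hlt : ∀ {n m}, n < m → EgliMilner r (F n) (F m) := by
    intro n m hnm
    induction m, hnm using Nat.le_induction with
    | base => exact hF n
    | succ m _ ih => exact h.egliMilner_trans ih (hF m)
  let K : Set X := ⋂ n, ⋃ a ∈ F n, B a
  let A : Set X := {x | ∀ a, x ∈ B a → ∃ n, ∃ b ∈ F n, r a b}
  have hA : IsClosed A := by
    have : Aᶜ = ⋃ a ∈ {a | ∀ n, ∀ b ∈ F n, ¬ r a b}, B a := by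
      ext x
      simp only [A, mem_compl_iff, mem_ofPred_eq, not_forall, not_exists, not_and, mem_iUnion,
        exists_prop]
      exact exists_congr fun a => and_comm
    rw [← isOpen_compl_iff, this]
    exact isOpen_biUnion fun a _ => h.isOpen a
  have hKU : ∀ n, IsOpen (⋃ a ∈ F n, B a) := fun n => isOpen_biUnion fun a _ => h.isOpen a
  have hKsat : IsSaturatedSet K := by
    refine Subset.antisymm (fun y hy U hU => hU.2 hy) fun y hy => ?_
    exact mem_iInter.2 fun n => hy _ ⟨hKU n, iInter_subset _ n⟩
  -- every chain through the levels `F n` converges to a point of `A ∩ K`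
  have hpt : ∀ s : ℕ → α, (∀ n, s n ∈ F n) → (∀ n, r (s n) (s (n + 1))) →
      ∃ x, x ∈ A ∧ x ∈ K ∧ ∀ a, x ∈ B a ↔ ∃ n, r a (s n) := by
    intro s hs hsr
    obtain ⟨x, hx⟩ := h.complete s hsr
    refine ⟨x, fun a ha => ?_, mem_iInter.2 fun n => ?_, hx⟩
    · obtain ⟨n, hn⟩ := (hx a).1 ha
      exact ⟨n, s n, hs n, hn⟩
    · exact mem_biUnion (hs n) ((hx _).2 ⟨n + 1, hsr n⟩)
  -- by König's lemma, an upward closed set of indices meeting the filter of basic neighbourhoods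
  -- of each point of `A ∩ K` contains a whole level
  have hbar : ∀ Q : Set α, (∀ a ∈ Q, ∀ b, r a b → b ∈ Q) →
      (∀ x ∈ A, x ∈ K → ∃ a ∈ Q, x ∈ B a) → ∃ n, ∀ b ∈ F n, b ∈ Q := by
    intro Q hQ hQx
    by_contra! hcon
    obtain ⟨s, hs, hsQ, hsr⟩ := exists_chain_of_finset_levels (r := r) F (· ∉ Q) hcon
      fun n b hb hbQ => by
        obtain ⟨a, ha, hab⟩ := (hF n).2 b hb
        exact ⟨a, ha, fun haQ => hbQ (hQ a haQ b hab), hab⟩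
    obtain ⟨x, hxA, hxK, hx⟩ := hpt s hs hsr
    obtain ⟨a, haQ, hxa⟩ := hQx x hxA hxK
    obtain ⟨n, hn⟩ := (hx a).1 hxa
    exact hsQ n (hQ a haQ _ hn)
  have hKc : IsCompact K := by
    refine isCompact_of_finite_subcover fun {ι} U hU hcov => ?_
    obtain ⟨n, hn⟩ := hbar {a | ∃ t : Finset ι, B a ⊆ ⋃ i ∈ t, U i}
      (fun a ⟨t, ht⟩ b hab => ⟨t, (h.anti hab).trans ht⟩) fun x _ hxK => by
        obtain ⟨i, hi⟩ := mem_iUnion.1 (hcov hxK)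
        obtain ⟨a, hxa, ha⟩ := h.exists_subset (hU i) hi
        exact ⟨a, ⟨{i}, by simpa using ha⟩, hxa⟩
    have hn' : ∀ b, ∃ t : Finset ι, b ∈ F n → B b ⊆ ⋃ i ∈ t, U i := fun b => by
      by_cases hb : b ∈ F n
      · obtain ⟨t, ht⟩ := hn b hb
        exact ⟨t, fun _ => ht⟩
      · exact ⟨∅, fun hb' => absurd hb' hb⟩
    choose t ht using hn'
    classical
    refine ⟨(F n).biUnion t, fun x hx => ?_⟩
    obtain ⟨b, hb, hxb⟩ := mem_iUnion₂.1 (mem_iInter.1 hx n)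
    obtain ⟨i, hi, hxi⟩ := mem_iUnion₂.1 (ht b hb hxb)
    exact mem_biUnion (Finset.mem_biUnion.2 ⟨b, hb, hi⟩) hxi
  refine ⟨⟨A ∩ K, ⟨A, hA⟩, ⟨K, hKc, hKsat⟩, rfl⟩, fun G => ⟨fun hG => ?_, fun ⟨n, hn⟩ => ?_⟩⟩
  · rw [mem_lensBasic] at hG
    obtain ⟨n, hn⟩ := hbar {b | ∃ a ∈ G, r a b}
      (fun a ⟨g, hg, hga⟩ b hab => ⟨g, hg, h.trans hga hab⟩)
      fun x hxA hxK => by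
        obtain ⟨g, hg, hxg⟩ := hG.1 x ⟨hxA, hxK⟩
        obtain ⟨c, hgc, -, hxc⟩ := h.directed hxg hxg
        exact ⟨c, ⟨g, hg, hgc⟩, hxc⟩
    have hlow : ∀ a, ∃ k, a ∈ G → ∃ b ∈ F k, r a b := fun a => by
      by_cases ha : a ∈ G
      · obtain ⟨x, hx, hxa⟩ := hG.2 a ha
        obtain ⟨k, hk⟩ := hx.1 a hxa
        exact ⟨k, fun _ => hk⟩
      · exact ⟨0, fun ha' => absurd ha' ha⟩
    choose k hk using hlow
    -- a level beyond all those at which one half of the relation has been found for `G`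
    refine ⟨max n (G.sup k) + 1, fun a ha => ?_, fun c hc => ?_⟩
    · obtain ⟨b, hb, hab⟩ := hk a ha
      have hka := Finset.le_sup (f := k) ha
      obtain ⟨c, hc, hbc⟩ := (hlt (show k a < max n (G.sup k) + 1 by omega)).1 b hb
      exact ⟨c, hc, h.trans hab hbc⟩
    · obtain ⟨b, hb, hbc⟩ := (hlt (show n < max n (G.sup k) + 1 by omega)).2 c hc
      obtain ⟨a, ha, hab⟩ := hn b hb
      exact ⟨a, ha, h.trans hab hbc⟩
  · refine h.lensBasic_anti hn (mem_lensBasic.2 ⟨fun x hx => ?_, fun b hb => ?_⟩)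
    · obtain ⟨b, hb, hxb⟩ := mem_iUnion₂.1 (mem_iInter.1 hx.2 n)
      exact ⟨b, hb, hxb⟩
    · choose! f hfF hfr using fun m => (hF m).1
      let s : ℕ → α := fun m => Nat.rec b (fun i a => f (n + i) a) m
      have hs : ∀ m, s m ∈ F (n + m) := fun m => by
        induction m with
        | zero => exact hb
        | succ m ih => exact hfF _ _ ih
      obtain ⟨x, hx⟩ := h.complete s fun m => hfr _ _ (hs m)
      refine ⟨x, ⟨fun a ha => ?_, mem_iInter.2 fun m => ?_⟩, (hx b).2 ⟨1, hfr _ _ hb⟩⟩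
      · obtain ⟨m, hm⟩ := (hx a).1 ha
        exact ⟨n + m, s m, hs m, hm⟩
      · -- the chain starts at level `n`, and `s (m + 1)` lies at a level beyond `m`
        obtain ⟨a, ha, hr⟩ := (hlt (show m < n + (m + 1) by omega)).2 _ (hs (m + 1))
        exact mem_biUnion ha ((hx a).2 ⟨m + 1, hr⟩)

theorem convexPowerspace (h : IsChainPresentation r B) :
    IsChainPresentation (EgliMilner r) (lensBasic B) where
  trans := h.egliMilner_trans
  isOpen := h.isOpen_lensBasic
  anti := h.lensBasic_anti
  exists_subset hU hx := h.exists_lensBasic_subset hU hx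
  directed := h.lensBasic_directed
  complete := h.exists_lens_of_egliMilner_chain

end IsChainPresentation

/-! ### The quasi-metric of a sequence of stages -/

section StageQuasiMetric

variable {X : Type u} {w : ℕ → X → ℕ∞}

open Classical in
/-- The quasi-metric of a sequence of functions `w k : X → ℕ∞`: the distance from `x` to `y` is
`2⁻ᵏ` for the least `k` with `w k x < w k y`, and `0` if there is no such `k`. -/
noncomputable def stageDist (w : ℕ → X → ℕ∞) (x y : X) : ℝ :=
  if h : ∃ k, w k x < w k y then (1 / 2) ^ Nat.find h else 0

theorem stageDist_nonneg (x y : X) : 0 ≤ stageDist w x y := by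
  unfold stageDist
  split_ifs <;> positivity

theorem stageDist_lt_pow {x y : X} {n : ℕ} :
    stageDist w x y < (1 / 2) ^ n ↔ ∀ k ≤ n, w k y ≤ w k x := by
  classical
  unfold stageDist
  split_ifs with h
  · rw [pow_lt_pow_iff_right_of_lt_one₀ (by norm_num) (by norm_num), Nat.lt_find_iff]
    simp
  · push Not at h
    exact iff_of_true (by positivity) fun k _ => h k

theorem stageDist_eq_zero {x y : X} : stageDist w x y = 0 ↔ ∀ k, w k y ≤ w k x := by
  refine ⟨fun h k => (stageDist_lt_pow (n := k)).1 (by rw [h]; positivity) k le_rfl, fun h => ?_⟩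
  simp [stageDist, fun k => not_lt.2 (h k)]

theorem stageDist_triangle (x y z : X) :
    stageDist w x z ≤ stageDist w x y + stageDist w y z := by
  by_contra! hlt
  have hne : stageDist w x z ≠ 0 :=
    (lt_of_le_of_lt (add_nonneg (stageDist_nonneg x y) (stageDist_nonneg y z)) hlt).ne'
  obtain ⟨n, hn⟩ : ∃ n : ℕ, stageDist w x z = (1 / 2) ^ n := by
    unfold stageDist at hne ⊢
    split_ifs with h
    · exact ⟨_, rfl⟩
    · simp [h] at hne
  have h1 := (stageDist_lt_pow (n := n)).1
    (by linarith [stageDist_nonneg (w := w) y z] : stageDist w x y < (1 / 2) ^ n)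
  have h2 := (stageDist_lt_pow (n := n)).1
    (by linarith [stageDist_nonneg (w := w) x y] : stageDist w y z < (1 / 2) ^ n)
  exact hn.not_lt (stageDist_lt_pow.2 fun k hk => (h2 k hk).trans (h1 k hk))

theorem isQuasiMetric_stageDist (hw : ∀ x y, (∀ k, w k x = w k y) → x = y) :
    IsQuasiMetric (stageDist w) where
  nonneg := stageDist_nonneg
  eq_iff x y := by
    rw [stageDist_eq_zero, stageDist_eq_zero]
    exact ⟨fun h => h ▸ ⟨fun _ => le_rfl, fun _ => le_rfl⟩,
      fun h => hw x y fun k => (h.2 k).antisymm (h.1 k)⟩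
  triangle := stageDist_triangle

/-- Along a Cauchy sequence `w k` eventually decreases, hence is eventually constant. -/
theorem IsQuasiCauchy.eventually_stage_eq {x : ℕ → X} (hx : IsQuasiCauchy (stageDist w) x)
    (k : ℕ) : ∃ v, ∀ᶠ n in atTop, w k (x n) = v := by
  obtain ⟨N, hN⟩ := hx ((1 / 2) ^ k) (by positivity)
  have hanti : Antitone fun n => w k (x (N + n)) := fun n m hnm =>
    stageDist_lt_pow.1 (hN (N + n) (N + m) (by omega) (by omega)) k le_rfl
  obtain ⟨n, hn⟩ := WellFoundedLT.antitone_chain_condition (f := fun n => w k (x (N + n))) hanti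
  refine ⟨w k (x (N + n)), eventually_atTop.2 ⟨N + n, fun m hm => ?_⟩⟩
  obtain ⟨i, rfl⟩ := Nat.exists_eq_add_of_le ((Nat.le_add_right N n).trans hm)
  exact (hn i (by omega)).symm

theorem tendsto_stageDist {x : ℕ → X} {a : X} (h : ∀ k, ∀ᶠ n in atTop, w k (x n) = w k a) :
    Tendsto (fun n => max (stageDist w (x n) a) (stageDist w a (x n))) atTop (𝓝 0) := by
  rw [tendsto_order]
  refine ⟨fun ε hε => .of_forall fun n =>
    hε.trans_le (le_max_of_le_left (stageDist_nonneg _ _)), fun ε hε => ?_⟩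
  obtain ⟨m, hm⟩ := exists_pow_lt_of_lt_one hε (by norm_num : (1 / 2 : ℝ) < 1)
  have : ∀ᶠ n in atTop, ∀ k ∈ Iic m, w k (x n) = w k a :=
    (eventually_all_finite (finite_Iic m)).2 fun k _ => h k
  filter_upwards [this] with n hn
  exact max_lt ((stageDist_lt_pow.2 fun k hk => (hn k hk).ge).trans hm)
    ((stageDist_lt_pow.2 fun k hk => (hn k hk).le).trans hm)

end StageQuasiMetric

section Stage

variable {X : Type u} {α : Type v} {B : α → Set X} {i : α → ℕ}

/-- The least code `i c` of an index `c ∈ T` with `x ∈ B c`, and `⊤` if there is none. -/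
noncomputable def stage (i : α → ℕ) (B : α → Set X) (T : Set α) (x : X) : ℕ∞ :=
  ⨅ c ∈ T ∩ {c | x ∈ B c}, (i c : ℕ∞)

theorem stage_le {T : Set α} {x : X} {c : α} (hc : c ∈ T) (hx : x ∈ B c) :
    stage i B T x ≤ i c :=
  iInf₂_le c ⟨hc, hx⟩

theorem exists_stage_eq {T : Set α} {x : X} (h : stage i B T x ≠ ⊤) :
    ∃ c ∈ T, x ∈ B c ∧ stage i B T x = i c := by
  have hne : ((fun c => (i c : ℕ∞)) '' (T ∩ {c | x ∈ B c})).Nonempty := by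
    by_contra hcon
    rw [not_nonempty_iff_eq_empty] at hcon
    exact h (by rw [stage, ← sInf_image, hcon, sInf_empty])
  obtain ⟨c, hc, hce⟩ := csInf_mem hne
  exact ⟨c, hc.1, hc.2, by rw [stage, ← sInf_image, ← hce]⟩

theorem stage_le_coe_iff {T : Set α} {x : X} {m : ℕ} :
    stage i B T x ≤ m ↔ ∃ c ∈ T, x ∈ B c ∧ i c ≤ m := by
  refine ⟨fun h => ?_, fun ⟨c, hc, hx, hm⟩ => (stage_le hc hx).trans (by exact_mod_cast hm)⟩
  obtain ⟨c, hc, hx, he⟩ := exists_stage_eq (h.trans_lt (ENat.natCast_lt_top m)).ne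
  exact ⟨c, hc, hx, by rw [he] at h; exact_mod_cast h⟩

theorem isOpen_setOf_stage_le [TopologicalSpace X] (hB : ∀ a, IsOpen (B a)) (T : Set α) (v : ℕ∞) :
    IsOpen {x | stage i B T x ≤ v} := by
  induction v with
  | top => simp
  | coe m =>
    have : {x | stage i B T x ≤ m} = ⋃ c ∈ {c | c ∈ T ∧ i c ≤ m}, B c := by
      ext x
      simp only [mem_ofPred_eq, stage_le_coe_iff, mem_iUnion, exists_prop]
      exact exists_congr fun c => by tauto
    rw [this]
    exact isOpen_biUnion fun c _ => hB c

theorem stage_singleton_le_iff {a : α} {x : X} : stage i B {a} x ≤ i a ↔ x ∈ B a := by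
  rw [stage_le_coe_iff]
  exact ⟨fun ⟨c, hc, hx, _⟩ => hc ▸ hx, fun hx => ⟨a, rfl, hx, le_rfl⟩⟩

end Stage

/-! ### Countably presented T₀ spaces are quasi-Polish -/

section Completeness

variable {X : Type u} {α : Type v} [TopologicalSpace X] {r : α → α → Prop} {B : α → Set X}

theorem IsChainPresentation.secondCountableTopology [Countable α] (h : IsChainPresentation r B) :
    SecondCountableTopology X :=
  (TopologicalSpace.isTopologicalBasis_of_isOpen_of_nhds (s := range B)
    (forall_mem_range.2 h.isOpen) fun x U hx hU => by
      obtain ⟨a, ha⟩ := h.exists_subset hU hx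
      exact ⟨B a, mem_range_self a, ha⟩).secondCountableTopology (countable_range B)

/-- A countable directed set has a cofinal chain, so completeness for chains gives completeness for
`r`-ideals. -/
theorem IsChainPresentation.exists_point_of_ideal [Countable α] (h : IsChainPresentation r B)
    (I : Set α) (hne : I.Nonempty) (hlow : ∀ a b, r a b → b ∈ I → a ∈ I)
    (hdir : ∀ a ∈ I, ∀ b ∈ I, ∃ c ∈ I, r a c ∧ r b c) :
    ∃ x, ∀ a, x ∈ B a ↔ a ∈ I := by
  have : Nonempty I := hne.to_subtype
  obtain ⟨e, he⟩ := exists_surjective_nat I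
  have hdir' : ∀ a b : I, ∃ c : I, r a c ∧ r b c := fun a b => by
    obtain ⟨c, hc, hac, hbc⟩ := hdir a a.2 b b.2
    exact ⟨⟨c, hc⟩, hac, hbc⟩
  choose f hf1 hf2 using hdir'
  let s : ℕ → I := fun n => Nat.rec (e 0) (fun k a => f a (e k)) n
  have hs : ∀ n, r (s n).1 (s (n + 1)).1 := fun n => hf1 (s n) (e n)
  obtain ⟨x, hx⟩ := h.complete (fun n => (s n).1) hs
  refine ⟨x, fun a => ⟨fun ha => ?_, fun ha => ?_⟩⟩
  · obtain ⟨n, hn⟩ := (hx a).1 ha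
    exact hlow a _ hn (s n).2
  · obtain ⟨n, hn⟩ := he ⟨a, ha⟩
    refine (hx a).2 ⟨n + 1, ?_⟩
    have hen : r (e n).1 (s (n + 1)).1 := hf2 (s n) (e n)
    rwa [hn] at hen

/-- The quasi-metric is `stageDist` for the stages of countably many families of indices. The
singletons make it induce the topology; `univ` and the sets of common refinements of two indices
make it complete, as the indices of the sets containing almost all terms of a Cauchy sequence then
form an ideal. -/
theorem IsChainPresentation.isQuasiPolish [Countable α] [T0Space X]
    (h : IsChainPresentation r B) : IsQuasiPolish X := by
  refine ⟨h.secondCountableTopology, ?_⟩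
  obtain ⟨i, hi⟩ := exists_injective_nat α
  -- the families whose stages are recorded: all indices, single indices, and the common
  -- refinements of two indices
  obtain ⟨T, hT⟩ := exists_surjective_nat (Option (α ⊕ α × α))
  let S : Option (α ⊕ α × α) → Set α := fun o =>
    o.elim univ (Sum.elim (fun a => {a}) fun p => {c | r p.1 c ∧ r p.2 c})
  let w : ℕ → X → ℕ∞ := fun k => stage i B (S (T k))
  have hwo : ∀ o, ∃ k, w k = stage i B (S o) := fun o => by
    obtain ⟨k, hk⟩ := hT o
    exact ⟨k, by simp only [w, hk]⟩
  have hwa : ∀ a, ∃ k, ∀ x, w k x ≤ i a ↔ x ∈ B a := fun a => by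
    obtain ⟨k, hk⟩ := hwo (some (.inl a))
    exact ⟨k, fun x => by rw [hk]; exact stage_singleton_le_iff⟩
  refine ⟨stageDist w, isQuasiMetric_stageDist fun x y hxy => ?_, fun U => ?_, fun x hx => ?_⟩
  · have hB : ∀ a, x ∈ B a ↔ y ∈ B a := fun a => by
      obtain ⟨k, hk⟩ := hwa a
      rw [← hk, ← hk, hxy]
    refine (inseparable_iff_forall_isOpen.2 fun U hU => ⟨fun hx => ?_, fun hy => ?_⟩).eq
    · obtain ⟨a, ha, haU⟩ := h.exists_subset hU hx
      exact haU ((hB a).1 ha)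
    · obtain ⟨a, ha, haU⟩ := h.exists_subset hU hy
      exact haU ((hB a).2 ha)
  · refine ⟨fun hU x hx => ?_, fun hU => isOpen_iff_mem_nhds.2 fun x hx => ?_⟩
    · obtain ⟨a, ha, haU⟩ := h.exists_subset hU hx
      obtain ⟨k, hk⟩ := hwa a
      refine ⟨(1 / 2) ^ k, by positivity, fun y hy => haU ?_⟩
      exact (hk y).1 ((stageDist_lt_pow.1 hy k le_rfl).trans ((hk x).2 ha))
    · obtain ⟨ε, hε, hεU⟩ := hU x hx
      obtain ⟨n, hn⟩ := exists_pow_lt_of_lt_one hε (by norm_num : (1 / 2 : ℝ) < 1)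
      have : IsOpen (⋂ k ∈ Iic n, {y | w k y ≤ w k x}) :=
        (finite_Iic n).isOpen_biInter fun k _ => isOpen_setOf_stage_le h.isOpen _ _
      refine mem_of_superset (this.mem_nhds (by simp)) fun y hy => hεU ?_
      exact (stageDist_lt_pow.2 fun k hk => mem_iInter₂.1 hy k hk).trans hn
  · choose v hv using hx.eventually_stage_eq
    let I : Set α := {a | ∀ᶠ n in atTop, x n ∈ B a}
    -- a basic set containing frequently many terms contains almost all of them
    have hfreq : ∀ a, (∃ᶠ n in atTop, x n ∈ B a) → a ∈ I := fun a ha => by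
      obtain ⟨k, hk⟩ := hwa a
      obtain ⟨n, hn, hnv⟩ := (ha.and_eventually (hv k)).exists
      filter_upwards [hv k] with m hm
      rw [← hk, hm, ← hnv, hk]
      exact hn
    -- a stage that is eventually finite is attained at an index of `I`
    have hatt : ∀ o k, w k = stage i B (S o) → v k ≠ ⊤ → ∃ c ∈ S o, c ∈ I ∧ v k = i c := by
      intro o k hk hvk
      obtain ⟨n, hn⟩ := (hv k).exists
      rw [hk] at hn
      obtain ⟨c, hcS, -, hc⟩ := exists_stage_eq (hn.trans_ne hvk)
      refine ⟨c, hcS, hfreq c (Eventually.frequently ?_), hn.symm.trans hc⟩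
      filter_upwards [hv k] with m hm
      rw [hk] at hm
      obtain ⟨c', -, hc'm, hc'⟩ := exists_stage_eq (hm.trans_ne hvk)
      have : i c' = i c := by exact_mod_cast (hc'.symm.trans (hm.trans hn.symm)).trans hc
      exact hi this ▸ hc'm
    have hle : ∀ o k, w k = stage i B (S o) → ∀ c ∈ S o, c ∈ I → v k ≤ i c := by
      intro o k hk c hcS hcI
      obtain ⟨n, hn, hnc⟩ := ((hv k).and hcI).exists
      rw [← hn, hk]
      exact stage_le hcS hnc
    have hex : ∀ o, (∃ᶠ n in atTop, ∃ c ∈ S o, x n ∈ B c) → ∃ c ∈ S o, c ∈ I := by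
      intro o ho
      obtain ⟨k, hk⟩ := hwo o
      obtain ⟨n, ⟨c, hcS, hnc⟩, hn⟩ := (ho.and_eventually (hv k)).exists
      have : v k ≠ ⊤ := by
        rw [← hn, hk]
        exact ((stage_le hcS hnc).trans_lt (ENat.natCast_lt_top _)).ne
      obtain ⟨c, hcS, hcI, -⟩ := hatt o k hk this
      exact ⟨c, hcS, hcI⟩
    obtain ⟨a, ha⟩ := h.exists_point_of_ideal I
      (by
        obtain ⟨c, -, hc⟩ := hex none (Frequently.of_forall fun n => by
          obtain ⟨c, hc, -⟩ := h.exists_subset isOpen_univ (mem_univ (x n))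
          exact ⟨c, trivial, hc⟩)
        exact ⟨c, hc⟩)
      (fun a b hab hb => hb.mono fun n hn => h.anti hab hn)
      (fun a ha b hb => by
        obtain ⟨c, hc, hcI⟩ := hex (some (.inr (a, b))) (ha.and hb |>.mono fun n hn => by
          obtain ⟨c, hac, hbc, hc⟩ := h.directed hn.1 hn.2
          exact ⟨c, ⟨hac, hbc⟩, hc⟩).frequently
        exact ⟨c, hcI, hc⟩)
    refine ⟨a, tendsto_stageDist fun k => ?_⟩
    have hva : v k = w k a := by
      refine le_antisymm ?_ ?_
      · by_cases hka : w k a = ⊤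
        · exact hka ▸ le_top
        · obtain ⟨c, hcS, hac, hc⟩ := exists_stage_eq hka
          exact (hle (T k) k rfl c hcS ((ha c).1 hac)).trans hc.ge
      · by_cases hvk : v k = ⊤
        · exact hvk ▸ le_top
        · obtain ⟨c, hcS, hcI, hc⟩ := hatt (T k) k rfl hvk
          exact hc ▸ stage_le hcS ((ha c).2 hcI)
    exact hva ▸ hv k

end Completeness

/-! ### The image of the embedding -/

section Image

variable {X : Type u} {α : Type v} [TopologicalSpace X] {r : α → α → Prop} {B : α → Set X}

theorem IsPiZeroTwo.of_countable {Y ι : Type*} [TopologicalSpace Y] [Countable ι] [Nonempty ι]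
    {S : Set Y} (U V : ι → Set Y) (hU : ∀ i, IsOpen (U i)) (hV : ∀ i, IsOpen (V i))
    (hS : ∀ y, y ∈ S ↔ ∀ i, y ∈ U i → y ∈ V i) : IsPiZeroTwo S := by
  obtain ⟨e, he⟩ := exists_surjective_nat ι
  exact ⟨U ∘ e, V ∘ e, fun n => hU _, fun n => hV _, fun y => (hS y).trans he.forall⟩

namespace IsChainPresentation

theorem isOpen_biUnion (h : IsChainPresentation r B) (F : Finset α) : IsOpen (⋃ a ∈ F, B a) :=
  _root_.isOpen_biUnion fun a _ => h.isOpen a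

theorem exists_finset_cover (h : IsChainPresentation r B) {K : Set X} (hK : IsCompact K)
    (P : α → Prop) (hP : ∀ x ∈ K, ∃ a, P a ∧ x ∈ B a) :
    ∃ F : Finset α, (∀ a ∈ F, P a) ∧ K ⊆ ⋃ a ∈ F, B a := by
  obtain ⟨F, hFP, hfin, hF⟩ := hK.elim_finite_subcover_image (b := {a | P a}) (c := B)
    (fun a _ => h.isOpen a) fun x hx => by
      obtain ⟨a, ha, hxa⟩ := hP x hx
      exact mem_biUnion (show a ∈ {a | P a} from ha) hxa
  exact ⟨hfin.toFinset, fun a ha => hFP (hfin.mem_toFinset.1 ha), by simpa using hF⟩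

/-- The Baire property of closed subsets: if the open sets `U n` are dense in `A`, then so is their
intersection. -/
theorem nonempty_inter_iInter (h : IsChainPresentation r B) {A V : Set X} (hA : IsClosed A)
    (hV : IsOpen V) (hAV : (A ∩ V).Nonempty) (U : ℕ → Set X) (hU : ∀ n, IsOpen (U n))
    (hd : ∀ n W, IsOpen W → (A ∩ W).Nonempty → (A ∩ (U n ∩ W)).Nonempty) :
    (A ∩ (⋂ n, U n) ∩ V).Nonempty := by
  obtain ⟨x₀, hx₀A, hx₀V⟩ := hAV
  obtain ⟨a₀, hxa₀, ha₀V⟩ := h.exists_subset hV hx₀V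
  have step : ∀ (n : ℕ) (a : α), ∃ b, (A ∩ B a).Nonempty →
      (A ∩ B b).Nonempty ∧ r a b ∧ B b ⊆ U n := fun n a => by
    by_cases ha : (A ∩ B a).Nonempty
    · obtain ⟨x, hxA, hxU, hxa⟩ := hd n _ (h.isOpen a) ha
      obtain ⟨b, hxb, hbU⟩ := h.exists_subset (hU n) hxU
      obtain ⟨c, hac, hbc, hxc⟩ := h.directed hxa hxb
      exact ⟨c, fun _ => ⟨⟨x, hxA, hxc⟩, hac, (h.anti hbc).trans hbU⟩⟩
    · exact ⟨a, fun ha' => absurd ha' ha⟩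
  choose f hf using step
  let s : ℕ → α := fun n => Nat.rec a₀ f n
  have hs : ∀ n, (A ∩ B (s n)).Nonempty := fun n => by
    induction n with
    | zero => exact ⟨x₀, hx₀A, hxa₀⟩
    | succ n ih => exact (hf n _ ih).1
  have hr : ∀ n, r (s n) (s (n + 1)) := fun n => (hf n _ (hs n)).2.1
  obtain ⟨x, hx⟩ := h.complete s hr
  have hxs : ∀ n, x ∈ B (s n) := fun n => (hx _).2 ⟨n + 1, hr n⟩
  refine ⟨x, ⟨?_, mem_iInter.2 fun n => (hf n _ (hs n)).2.2 (hxs (n + 1))⟩, ha₀V (hxs 0)⟩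
  by_contra hxA
  obtain ⟨a, hxa, haA⟩ := h.exists_subset hA.isOpen_compl hxA
  obtain ⟨n, hn⟩ := (hx a).1 hxa
  obtain ⟨y, hyA, hy⟩ := hs n
  exact haA (h.anti hn hy) hyA

/-- The `Π⁰₂` description of the pairs `(closure L, ↑L)`. -/
theorem mem_range_toProd_iff [Countable α] (h : IsChainPresentation r B)
    (p : LowerPowerspace X × UpperPowerspace X) :
    p ∈ range ConvexPowerspace.toProd ↔
      (∀ F G : Finset α, p.2.carrier ⊆ (⋃ a ∈ F, B a) ∪ (⋃ a ∈ G, B a) →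
        p.2.carrier ⊆ (⋃ a ∈ F, B a) ∨ (p.1.carrier ∩ ⋃ a ∈ G, B a).Nonempty) ∧
      ∀ (F : Finset α) (a : α), p.2.carrier ⊆ (⋃ a ∈ F, B a) → (p.1.carrier ∩ B a).Nonempty →
        (p.1.carrier ∩ ((⋃ a ∈ F, B a) ∩ B a)).Nonempty := by
  classical
  constructor
  · rintro ⟨L, rfl⟩
    refine ⟨fun F G hFG => ?_, fun F a hF ha => ?_⟩
    · rw [L.toProd_snd_subset ((h.isOpen_biUnion F).union (h.isOpen_biUnion G))] at hFG
      rw [L.toProd_snd_subset (h.isOpen_biUnion F),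
        L.toProd_fst_inter_nonempty (h.isOpen_biUnion G)]
      by_contra! hcon
      refine hcon.1 fun x hx => (hFG hx).resolve_right fun hxG => ?_
      exact (hcon.2 ▸ ⟨hx, hxG⟩ : x ∈ (∅ : Set X))
    · rw [L.toProd_snd_subset (h.isOpen_biUnion F)] at hF
      rw [L.toProd_fst_inter_nonempty (h.isOpen a)] at ha
      rw [L.toProd_fst_inter_nonempty ((h.isOpen_biUnion F).inter (h.isOpen a))]
      obtain ⟨x, hx, hxa⟩ := ha
      exact ⟨x, hx, hF hx, hxa⟩
  · obtain ⟨A, K⟩ := p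
    rintro ⟨h1, h2⟩
    simp only at h1 h2
    rw [ConvexPowerspace.range_toProd]
    refine ⟨(A.isClosed.closure_subset_iff.2 inter_subset_left).antisymm fun x hx => ?_,
      (K.isSaturated.specUp_subset inter_subset_right).antisymm fun y hy => ?_⟩
    · rw [mem_closure_iff]
      intro V hV hxV
      obtain ⟨e, he⟩ := exists_surjective_nat (Finset α)
      -- the finite unions of basic open sets that contain `K`, whose intersection is `K`
      let U : ℕ → Set X := fun n =>
        if K.carrier ⊆ ⋃ a ∈ e n, B a then ⋃ a ∈ e n, B a else univ
      have hUK : ⋂ n, U n ⊆ K.carrier := by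
        rw [K.isSaturated]
        rintro y hy O ⟨hO, hKO⟩
        obtain ⟨F, hFO, hKF⟩ := h.exists_finset_cover K.isCompact (fun a => B a ⊆ O) fun z hz => by
          obtain ⟨a, hza, ha⟩ := h.exists_subset hO (hKO hz)
          exact ⟨a, ha, hza⟩
        obtain ⟨n, rfl⟩ := he F
        have hyn := mem_iInter.1 hy n
        simp only [U, if_pos hKF] at hyn
        obtain ⟨a, ha, hya⟩ := mem_iUnion₂.1 hyn
        exact hFO a ha hya
      obtain ⟨z, ⟨hzA, hzU⟩, hzV⟩ := h.nonempty_inter_iInter A.isClosed hV ⟨x, hx, hxV⟩ U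
        (fun n => by
          simp only [U]
          split_ifs
          exacts [h.isOpen_biUnion _, isOpen_univ])
        (fun n W hW ⟨z, hzA, hzW⟩ => by
          simp only [U]
          split_ifs with hK
          · obtain ⟨a, hza, haW⟩ := h.exists_subset hW hzW
            exact (h2 (e n) a hK ⟨z, hzA, hza⟩).mono
              (inter_subset_inter_right _ (inter_subset_inter_right _ haW))
          · exact ⟨z, hzA, trivial, hzW⟩)
      exact ⟨z, hzV, hzA, hUK hzU⟩
    · by_contra hyn
      obtain ⟨O, hO, hKO, hyO⟩ := exists_isOpen_of_notMem_specUp hyn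
      obtain ⟨F, hF, hKF⟩ := h.exists_finset_cover K.isCompact
        (fun a => B a ⊆ O ∨ B a ⊆ A.carrierᶜ) fun z hz => by
          by_cases hzA : z ∈ A.carrier
          · obtain ⟨a, hza, ha⟩ := h.exists_subset hO (hKO ⟨hzA, hz⟩)
            exact ⟨a, .inl ha, hza⟩
          · obtain ⟨a, hza, ha⟩ := h.exists_subset A.isClosed.isOpen_compl hzA
            exact ⟨a, .inr ha, hza⟩
      -- the cover of `K` is split into the sets inside `O` and those disjoint from `A`
      rcases h1 (F.filter fun a => B a ⊆ O) (F.filter fun a => ¬ B a ⊆ O) (fun z hz => by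
        obtain ⟨a, ha, hza⟩ := mem_iUnion₂.1 (hKF hz)
        by_cases haO : B a ⊆ O
        · exact .inl (mem_biUnion (Finset.mem_filter.2 ⟨ha, haO⟩) hza)
        · exact .inr (mem_biUnion (Finset.mem_filter.2 ⟨ha, haO⟩) hza)) with hK | ⟨z, hzA, hz⟩
      · obtain ⟨a, ha, hya⟩ := mem_iUnion₂.1 (hK hy)
        exact hyO ((Finset.mem_filter.1 ha).2 hya)
      · obtain ⟨a, ha, hza⟩ := mem_iUnion₂.1 hz
        obtain ⟨haF, haO⟩ := Finset.mem_filter.1 ha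
        exact (hF a haF).resolve_left haO hza hzA

theorem isPiZeroTwo_range_toProd [Countable α] (h : IsChainPresentation r B) :
    IsPiZeroTwo (range (ConvexPowerspace.toProd : ConvexPowerspace X → _)) := by
  have hbox : ∀ {U : Set X}, IsOpen U →
      IsOpen {p : LowerPowerspace X × UpperPowerspace X | p.2.carrier ⊆ U} := fun hU =>
    (UpperPowerspace.isOpen_box hU).preimage continuous_snd
  have hdia : ∀ {U : Set X}, IsOpen U →
      IsOpen {p : LowerPowerspace X × UpperPowerspace X | (p.1.carrier ∩ U).Nonempty} := fun hU =>
    (LowerPowerspace.isOpen_diamond hU).preimage continuous_fst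
  refine .of_countable (ι := (Finset α × Finset α) ⊕ Finset α × α)
    (Sum.elim
      (fun q => {p | p.2.carrier ⊆ (⋃ a ∈ q.1, B a) ∪ ⋃ a ∈ q.2, B a})
      (fun q => {p | p.2.carrier ⊆ ⋃ a ∈ q.1, B a} ∩ {p | (p.1.carrier ∩ B q.2).Nonempty}))
    (Sum.elim
      (fun q => {p | p.2.carrier ⊆ ⋃ a ∈ q.1, B a} ∪
        {p | (p.1.carrier ∩ ⋃ a ∈ q.2, B a).Nonempty})
      (fun q => {p | (p.1.carrier ∩ ((⋃ a ∈ q.1, B a) ∩ B q.2)).Nonempty})) ?_ ?_ fun p => ?_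
  · rintro (q | q)
    · exact hbox ((h.isOpen_biUnion _).union (h.isOpen_biUnion _))
    · exact (hbox (h.isOpen_biUnion _)).inter (hdia (h.isOpen _))
  · rintro (q | q)
    · exact (hbox (h.isOpen_biUnion _)).union (hdia (h.isOpen_biUnion _))
    · exact hdia ((h.isOpen_biUnion _).inter (h.isOpen _))
  · rw [h.mem_range_toProd_iff, Sum.forall, Prod.forall, Prod.forall]
    simp only [Sum.elim_inl, Sum.elim_inr, mem_inter_iff, mem_union, mem_ofPred_eq, and_imp]

end IsChainPresentation

end Image

theorem mainTheorem7 (X : Type*) [TopologicalSpace X] (hX : IsQuasiPolish X) :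
    IsQuasiPolish (ConvexPowerspace X) ∧
      ∃ e : ConvexPowerspace X → LowerPowerspace X × UpperPowerspace X,
        (∀ L, (e L).1.carrier = closure L.carrier ∧ (e L).2.carrier = specUp L.carrier) ∧
        IsEmbedding e ∧
        range e = {p | closure (p.1.carrier ∩ p.2.carrier) = p.1.carrier ∧
          specUp (p.1.carrier ∩ p.2.carrier) = p.2.carrier} ∧
        IsPiZeroTwo (range e) := by
  obtain ⟨α, r, B, _, h⟩ := hX.exists_chainPresentation
  exact ⟨h.convexPowerspace.isQuasiPolish, ConvexPowerspace.toProd, fun L => ⟨rfl, rfl⟩,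
    ConvexPowerspace.isEmbedding_toProd, ConvexPowerspace.range_toProd, h.isPiZeroTwo_range_toProd⟩
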